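/- A digraph is a directed graph without loops and without multiple arcs; a pair of opposite arcs $(a,b)$, $(b,a)$ is allowed. For a finite digraph $D$ with vertex set $V(D)$ and arc set $E(D)$, a probability space $(\Omega,\mathcal F,\mu)$ and a kernel $h$, that is, a (not necessarily symmetric) measurable function $h:\Omega^2\to[0,1]$, put \[ U_D(h):=\int_{\Omega^{V(D)}}\ \prod_{(a,b)\in E(D)} h(x_a,x_b)\ \prod_{v\in V(D)}\mathrm d\mu(x_v). \] For finite digraphs $D$ and $H$, with $V(H)$ nonempty, put \[ t(D,H):=\frac{\hom(D,H)}{|V(H)|^{|V(D)|}}, \] where $\hom(D,H)$ is the number of maps $\varphi:V(D)\to V(H)$ such that $(\varphi(a),\varphi(b))\in E(H)$ for all $(a,b)\in E(D)$. Proposition (Equivalence of analytic and combinatorial orders). Let $D$ and $F$ be finite digraphs. The following are equivalent. (i) $U_D(h)\ge U_F(h)$ for all standard probability spaces $(\Omega,\mathcal F,\mu)$ (standard Borel spaces with a probability measure) and all kernels $h:\Omega^2\to[0,1]$. (ii) $t(D,H)\ge t(F,H)$ for all finite digraphs $H$ with at least one vertex. -/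

import Mathlib

open MeasureTheory

namespace Digraph

/-- A digraph without loops. Multiple arcs are excluded by the type `Digraph`; a pair of opposite
arcs `a → b`, `b → a` is allowed. -/
def IsLoopless {V : Type*} (D : Digraph V) : Prop := ∀ v, ¬ D.Adj v v

/-- The number of digraph homomorphisms from `D` to `H`, that is, of the maps of vertices that send
arcs to arcs. -/
noncomputable def homCount {V W : Type*} (D : Digraph V) (H : Digraph W) : ℕ :=
  Nat.card {φ : V → W // ∀ a b, D.Adj a b → H.Adj (φ a) (φ b)}

/-- The homomorphism density `t(D, H) = hom(D, H) / |V(H)| ^ |V(D)|`. -/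
noncomputable def homDensity {V W : Type*} (D : Digraph V) (H : Digraph W) : ℝ :=
  (homCount D H : ℝ) / (Nat.card W : ℝ) ^ Nat.card V

open Classical in
/-- The finite set of arcs of a finite digraph. -/
noncomputable def arcs {V : Type*} [Fintype V] (D : Digraph V) : Finset (V × V) :=
  Finset.univ.filter fun e => D.Adj e.1 e.2

/-- The configuration product integral
`U_D(h) = ∫ ∏_{(a, b) ∈ E(D)} h (x_a, x_b) ∏_v dμ(x_v)`. -/
noncomputable def configIntegral {V Ω : Type*} [Fintype V] [MeasurableSpace Ω]
    (D : Digraph V) (μ : Measure Ω) (h : Ω × Ω → ℝ) : ℝ :=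
  ∫ x : V → Ω, ∏ e ∈ D.arcs, h (x e.1, x e.2) ∂(Measure.pi fun _ : V => μ)

end Digraph

/-- A kernel on `Ω`: a measurable function `Ω² → [0, 1]`, not assumed symmetric. -/
def IsKernelFunction {Ω : Type*} [MeasurableSpace Ω] (h : Ω × Ω → ℝ) : Prop :=
  Measurable h ∧ ∀ p, h p ∈ Set.Icc (0 : ℝ) 1

open MeasureTheory ProbabilityTheory Filter Topology

namespace Finset

/-! A density in `H` is the configuration integral of the adjacency indicator of `H` under the
uniform measure, so the analytic order implies the combinatorial one (`configIntegral_uniform`).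
Conversely, draw the points of a finite set independently from `μ` and join `a` to `b` with
probability `h (x a, x b)`, dropping loops. Averaging the combinatorial inequality over this random
digraph compares expected densities (`expectedDensity_mono`). An injective map is a homomorphism
with probability exactly the configuration integral (`integral_homProb_of_injective`), and almost
all maps into a large set are injective, so the expected densities converge to the configuration
integrals (`tendsto_expectedDensity`) and the inequality survives the limit. -/

/-- If every `a : α` is selected independently with probability `p a`, then all elements of `A` are
selected with probability `∏ a ∈ A, p a`. -/
theorem sum_prod_mul_prod_compl_mul_ite_subset {α : Type*} [Fintype α] [DecidableEq α]
    (p : α → ℝ) (A : Finset α) :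
    ∑ S : Finset α, ((∏ a ∈ S, p a) * ∏ a ∈ Sᶜ, (1 - p a)) * (if A ⊆ S then 1 else 0) =
      ∏ a ∈ A, p a := by
  have hsum := Fintype.prod_add p fun a => if a ∈ A then 0 else 1 - p a
  have hprod : ∏ a, (p a + if a ∈ A then 0 else 1 - p a) = ∏ a ∈ A, p a := by
    rw [← Finset.prod_subset (Finset.subset_univ A)]
    · exact Finset.prod_congr rfl fun a ha => by simp [ha]
    · intro a _ ha
      simp [ha]
  rw [← hprod, hsum]
  refine Finset.sum_congr rfl fun S _ => ?_
  split_ifs with hS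
  · rw [mul_one]
    congr 1
    refine Finset.prod_congr rfl fun a ha => ?_
    rw [if_neg fun haA => (Finset.mem_compl.mp ha) (hS haA)]
  · obtain ⟨a, haA, haS⟩ := Finset.not_subset.mp hS
    rw [mul_zero, Finset.prod_eq_zero (Finset.mem_compl.mpr haS) (by simp [haA]), mul_zero]

end Finset

namespace MeasureTheory

/-- Restricting a product of copies of a probability measure along an injection of the index types
gives a product of copies of that measure. -/
theorem measurePreserving_comp_of_injective {V X Ω : Type*} [Fintype V] [Fintype X]
    [MeasurableSpace Ω] (μ : Measure Ω) [IsProbabilityMeasure μ] {φ : V → X}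
    (hφ : Function.Injective φ) :
    MeasurePreserving (fun x : X → Ω => fun v => x (φ v))
      (Measure.pi fun _ => μ) (Measure.pi fun _ => μ) := by
  refine ⟨by fun_prop, ?_⟩
  -- A subfamily of independent coordinates is independent, so its joint law is the product of its
  -- marginals.
  have hind : iIndepFun (fun (i : X) (x : X → Ω) => x i) (Measure.pi fun _ => μ) :=
    iIndepFun_pi (X := fun _ => id) fun _ => aemeasurable_id
  have hmap := (iIndepFun_iff_map_fun_eq_pi_map
    (fun v => (measurable_pi_apply (φ v)).aemeasurable)).mp (hind.precomp hφ)
  rw [hmap]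
  congr 1
  funext v
  exact (measurePreserving_eval (fun _ : X => μ) (φ v)).map_eq

end MeasureTheory

namespace Digraph

variable {V W X Y Ω : Type*}

@[simp]
theorem mem_arcs [Fintype V] (D : Digraph V) (e : V × V) : e ∈ D.arcs ↔ D.Adj e.1 e.2 := by
  simp [arcs]

open Classical in
theorem homCount_eq_sum [Fintype V] [DecidableEq V] [Fintype X] (D : Digraph V) (H : Digraph X) :
    (homCount D H : ℝ) =
      ∑ φ : V → X, if ∀ a b, D.Adj a b → H.Adj (φ a) (φ b) then (1 : ℝ) else 0 := by
  rw [homCount, Nat.card_eq_fintype_card, Fintype.card_subtype]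
  simp

/-- The digraph on `Y` whose arcs are the pairs that `f` sends to arcs of `H`. -/
def pullback (f : Y → X) (H : Digraph X) : Digraph Y where
  Adj a b := H.Adj (f a) (f b)

theorem homCount_pullback_equiv (D : Digraph V) (H : Digraph X) (e : Y ≃ X) :
    homCount D (H.pullback e) = homCount D H := by
  refine Nat.card_congr ((Equiv.arrowCongr (Equiv.refl V) e).subtypeEquiv fun φ => ?_)
  simp [pullback]

theorem homDensity_pullback_equiv (D : Digraph V) (H : Digraph X) (e : Y ≃ X) :
    homDensity D (H.pullback e) = homDensity D H := by
  rw [homDensity, homDensity, homCount_pullback_equiv, Nat.card_congr e]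

section ConfigIntegral

variable [Fintype V] [MeasurableSpace Ω]

theorem prod_arcs_mem_Icc (D : Digraph V) {h : Ω × Ω → ℝ} (hh : IsKernelFunction h) (x : V → Ω) :
    ∏ e ∈ D.arcs, h (x e.1, x e.2) ∈ Set.Icc (0 : ℝ) 1 :=
  ⟨Finset.prod_nonneg fun _ _ => (hh.2 _).1,
    Finset.prod_le_one (fun _ _ => (hh.2 _).1) fun _ _ => (hh.2 _).2⟩

open Classical in
/-- The density of homomorphisms to a finite digraph is a configuration integral over the uniform
measure on its vertices. -/
theorem configIntegral_uniform [DecidableEq V] [Fintype Y] [Nonempty Y] [MeasurableSpace Y]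
    [DiscreteMeasurableSpace Y] (D : Digraph V) (H : Digraph Y) :
    D.configIntegral (uniformOn (Set.univ : Set Y))
      (fun p => if H.Adj p.1 p.2 then 1 else 0) = D.homDensity H := by
  have : IsProbabilityMeasure (uniformOn (Set.univ : Set Y)) :=
    isProbabilityMeasure_uniformOn Set.finite_univ Set.univ_nonempty
  have hsing (y : Y) : (uniformOn (Set.univ : Set Y)) {y} = (Fintype.card Y : ENNReal)⁻¹ := by
    rw [uniformOn_univ, Measure.count_singleton, one_div]
  rw [configIntegral, integral_fintype (Integrable.of_finite), homDensity, homCount_eq_sum,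
    Finset.sum_div]
  refine Finset.sum_congr rfl fun φ _ => ?_
  have hφ : (Measure.pi fun _ : V => uniformOn (Set.univ : Set Y)).real {φ} =
      ((Fintype.card Y : ℝ) ^ Fintype.card V)⁻¹ := by
    rw [measureReal_def, Measure.pi_singleton]
    simp [hsing]
  rw [hφ, smul_eq_mul, Finset.prod_ite_zero]
  simp [div_eq_inv_mul]

end ConfigIntegral

/-! ### Random digraphs sampled from a kernel -/

section Sampling

/-- The loopless digraph whose arcs are the off-diagonal pairs of a given finite set. -/
def ofPairs (S : Finset (X × X)) : Digraph X where
  Adj a b := a ≠ b ∧ (a, b) ∈ S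

theorem isLoopless_ofPairs (S : Finset (X × X)) : (ofPairs S).IsLoopless :=
  fun _ hv => hv.1 rfl

variable [Fintype X] [DecidableEq X]

/-- The probability that the set `S` of pairs is selected when each pair `(a, b)` is selected
independently with probability `h (x a, x b)`. -/
def pairsWeight (h : Ω × Ω → ℝ) (x : X → Ω) (S : Finset (X × X)) : ℝ :=
  (∏ e ∈ S, h (x e.1, x e.2)) * ∏ e ∈ Sᶜ, (1 - h (x e.1, x e.2))

open Classical in
/-- The probability that `φ` is a homomorphism from `D` to the random digraph on `X` that is sampled
from the kernel `h` at the points `x`. -/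
noncomputable def homProb (D : Digraph V) (h : Ω × Ω → ℝ) (φ : V → X) (x : X → Ω) : ℝ :=
  ∑ S : Finset (X × X), pairsWeight h x S *
    if ∀ a b, D.Adj a b → (ofPairs S).Adj (φ a) (φ b) then 1 else 0

theorem sum_pairsWeight (h : Ω × Ω → ℝ) (x : X → Ω) :
    ∑ S : Finset (X × X), pairsWeight h x S = 1 := by
  simpa [pairsWeight] using Finset.sum_prod_mul_prod_compl_mul_ite_subset
    (fun e : X × X => h (x e.1, x e.2)) ∅

theorem sum_pairsWeight_mul_homDensity [Fintype V] [DecidableEq V] (D : Digraph V) (h : Ω × Ω → ℝ) (x : X → Ω) :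
    ∑ S : Finset (X × X), pairsWeight h x S * D.homDensity (ofPairs S) =
      (∑ φ : V → X, homProb D h φ x) / (Fintype.card X : ℝ) ^ Fintype.card V := by
  simp only [homProb, homDensity, homCount_eq_sum, Nat.card_eq_fintype_card]
  rw [Finset.sum_comm, Finset.sum_div]
  refine Finset.sum_congr rfl fun S _ => ?_
  rw [← Finset.mul_sum, mul_div_assoc]
  congr!

/-- Injectivity sends distinct arcs to distinct pairs, whose selections are independent; with
looplessness, no arc lands on the diagonal, where `ofPairs` discards pairs. -/
theorem homProb_of_injective [Fintype V] {D : Digraph V} (hD : D.IsLoopless) (h : Ω × Ω → ℝ)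
    {φ : V → X} (hφ : Function.Injective φ) (x : X → Ω) :
    homProb D h φ x = ∏ e ∈ D.arcs, h (x (φ e.1), x (φ e.2)) := by
  have hsum := Finset.sum_prod_mul_prod_compl_mul_ite_subset
    (fun e : X × X => h (x e.1, x e.2)) (D.arcs.image (Prod.map φ φ))
  rw [Finset.prod_image ((hφ.prodMap hφ).injOn)] at hsum
  simp only [Prod.map_fst, Prod.map_snd] at hsum
  rw [← hsum, homProb]
  refine Finset.sum_congr rfl fun S _ => ?_
  rw [pairsWeight]
  have hiff : (∀ a b, D.Adj a b → (ofPairs S).Adj (φ a) (φ b)) ↔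
      D.arcs.image (Prod.map φ φ) ⊆ S := by
    rw [Finset.image_subset_iff]
    constructor
    · intro hS e he
      exact (hS e.1 e.2 ((mem_arcs D e).mp he)).2
    · intro hS a b hab
      refine ⟨fun heq => ?_, hS (a, b) ((mem_arcs D (a, b)).mpr hab)⟩
      rw [hφ heq] at hab
      exact hD b hab
  simp only [hiff]

variable [MeasurableSpace Ω] {h : Ω × Ω → ℝ}

theorem pairsWeight_nonneg (hh : IsKernelFunction h) (x : X → Ω) (S : Finset (X × X)) :
    0 ≤ pairsWeight h x S :=
  mul_nonneg (Finset.prod_nonneg fun _ _ => (hh.2 _).1)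
    (Finset.prod_nonneg fun _ _ => sub_nonneg.mpr (hh.2 _).2)

theorem homProb_mem_Icc (D : Digraph V) (hh : IsKernelFunction h) (φ : V → X) (x : X → Ω) :
    homProb D h φ x ∈ Set.Icc (0 : ℝ) 1 := by
  constructor
  · exact Finset.sum_nonneg fun S _ =>
      mul_nonneg (pairsWeight_nonneg hh x S) (by split_ifs <;> norm_num)
  · rw [← sum_pairsWeight h x]
    exact Finset.sum_le_sum fun S _ =>
      mul_le_of_le_one_right (pairsWeight_nonneg hh x S) (by split_ifs <;> norm_num)

theorem measurable_homProb (D : Digraph V) (hh : IsKernelFunction h) (φ : V → X) :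
    Measurable (homProb D h φ) := by
  have := hh.1
  unfold homProb pairsWeight
  fun_prop

variable (μ : Measure Ω) [IsProbabilityMeasure μ]

theorem integrable_homProb (D : Digraph V) (hh : IsKernelFunction h) (φ : V → X) :
    Integrable (homProb D h φ) (Measure.pi fun _ => μ) :=
  .of_mem_Icc 0 1 (measurable_homProb D hh φ).aemeasurable
    (.of_forall (homProb_mem_Icc D hh φ))

theorem integral_homProb_mem_Icc (D : Digraph V) (hh : IsKernelFunction h) (φ : V → X) :
    ∫ x, homProb D h φ x ∂(Measure.pi fun _ => μ) ∈ Set.Icc (0 : ℝ) 1 := by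
  refine ⟨integral_nonneg fun x => (homProb_mem_Icc D hh φ x).1, ?_⟩
  simpa using integral_mono (integrable_homProb μ D hh φ) (integrable_const 1)
    fun x => (homProb_mem_Icc D hh φ x).2

variable [Fintype V]

theorem integral_homProb_of_injective {D : Digraph V} (hD : D.IsLoopless)
    (hh : IsKernelFunction h) {φ : V → X} (hφ : Function.Injective φ) :
    ∫ x, homProb D h φ x ∂(Measure.pi fun _ => μ) = D.configIntegral μ h := by
  have hmp := measurePreserving_comp_of_injective μ hφ
  have hmeas : Measurable fun y : V → Ω => ∏ e ∈ D.arcs, h (y e.1, y e.2) := by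
    have := hh.1
    fun_prop
  rw [configIntegral, ← hmp.map_eq, integral_map hmp.measurable.aemeasurable
    hmeas.aestronglyMeasurable]
  simp only [homProb_of_injective hD h hφ]

variable [DecidableEq V]

/-- The expected homomorphism density of `D` in the random digraph on `X` that is sampled from the
kernel `h`. -/
noncomputable def expectedDensity (X : Type*) [Fintype X] [DecidableEq X] (D : Digraph V)
    (μ : Measure Ω) (h : Ω × Ω → ℝ) : ℝ :=
  (∑ φ : V → X, ∫ x, homProb D h φ x ∂(Measure.pi fun _ => μ)) /
    (Fintype.card X : ℝ) ^ Fintype.card V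

/-- For fixed `x`, each side is a weighted average of densities in loopless digraphs, with the same
nonnegative weights; integrate over `x`. -/
theorem expectedDensity_mono [Fintype W] [DecidableEq W] [Nonempty X] {D : Digraph V} {F : Digraph W}
    (hDF : ∀ H : Digraph X, H.IsLoopless → F.homDensity H ≤ D.homDensity H)
    (hh : IsKernelFunction h) : expectedDensity X F μ h ≤ expectedDensity X D μ h := by
  rw [expectedDensity, expectedDensity,
    ← integral_finsetSum _ fun φ _ => integrable_homProb μ F hh φ,
    ← integral_finsetSum _ fun φ _ => integrable_homProb μ D hh φ,
    ← integral_div, ← integral_div]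
  refine integral_mono ((integrable_finsetSum _ fun φ _ => integrable_homProb μ F hh φ).div_const _)
    ((integrable_finsetSum _ fun φ _ => integrable_homProb μ D hh φ).div_const _) fun x => ?_
  simp only
  rw [← sum_pairsWeight_mul_homDensity, ← sum_pairsWeight_mul_homDensity]
  exact Finset.sum_le_sum fun S _ => mul_le_mul_of_nonneg_left
    (hDF _ (isLoopless_ofPairs S)) (pairsWeight_nonneg hh x S)

/-- Only the maps that are not injective contribute to the difference between the expected density
and the configuration integral. -/
theorem abs_expectedDensity_sub_configIntegral_le [Nonempty X] {D : Digraph V}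
    (hD : D.IsLoopless) (hh : IsKernelFunction h) :
    |expectedDensity X D μ h - D.configIntegral μ h| ≤
      1 - ((Fintype.card X).descFactorial (Fintype.card V) : ℝ) /
        (Fintype.card X : ℝ) ^ Fintype.card V := by
  classical
  set N : ℝ := (Fintype.card X : ℝ) ^ Fintype.card V with hN
  have hNpos : 0 < N := by
    have : 0 < Fintype.card X := Fintype.card_pos
    positivity
  have hcard : (∑ _φ : V → X, (1 : ℝ)) = N := by simp [hN]
  have hinj : (∑ φ : V → X, if Function.Injective φ then (1 : ℝ) else 0) =
      (Fintype.card X).descFactorial (Fintype.card V) := by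
    rw [← Fintype.card_embedding_eq, ← Fintype.card_congr
      (Equiv.subtypeInjectiveEquivEmbedding V X), Fintype.card_subtype]
    simp
  have hU : D.configIntegral μ h ∈ Set.Icc (0 : ℝ) 1 := by
    refine ⟨integral_nonneg fun x => (prod_arcs_mem_Icc D hh x).1, ?_⟩
    have hmeas : Measurable fun y : V → Ω => ∏ e ∈ D.arcs, h (y e.1, y e.2) := by
      have := hh.1
      fun_prop
    simpa [configIntegral] using integral_mono (μ := Measure.pi fun _ : V => μ)
      (.of_mem_Icc 0 1 hmeas.aemeasurable (.of_forall (prod_arcs_mem_Icc D hh)))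
      (integrable_const 1) fun x => (prod_arcs_mem_Icc D hh x).2
  have hdiff : expectedDensity X D μ h - D.configIntegral μ h =
      (∑ φ : V → X, (∫ x, homProb D h φ x ∂(Measure.pi fun _ => μ) -
        D.configIntegral μ h)) / N := by
    rw [Finset.sum_sub_distrib, sub_div, ← mul_one (D.configIntegral μ h), ← Finset.mul_sum, hcard,
      mul_div_cancel_right₀ _ hNpos.ne', mul_one, expectedDensity]
  have hbound : 1 - ((Fintype.card X).descFactorial (Fintype.card V) : ℝ) / N =
      (∑ φ : V → X, (1 - if Function.Injective φ then (1 : ℝ) else 0)) / N := by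
    rw [Finset.sum_sub_distrib, hcard, hinj, sub_div, div_self hNpos.ne']
  rw [hdiff, hbound, abs_div, abs_of_pos hNpos]
  refine div_le_div_of_nonneg_right ((Finset.abs_sum_le_sum_abs _ _).trans ?_) hNpos.le
  refine Finset.sum_le_sum fun φ _ => ?_
  split_ifs with hφ
  · simp [integral_homProb_of_injective μ hD hh hφ]
  -- Both quantities lie in `[0, 1]`, so a map that is not injective contributes at most `1`.
  · have := integral_homProb_mem_Icc μ D hh φ
    rw [abs_le]
    constructor <;> linarith [this.1, this.2, hU.1, hU.2]

end Sampling

/-- Expected densities in ever larger samples from a kernel tend to the configuration integral. -/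
theorem tendsto_expectedDensity [Fintype V] [DecidableEq V] [MeasurableSpace Ω] {D : Digraph V}
    (hD : D.IsLoopless) (μ : Measure Ω) [IsProbabilityMeasure μ] {h : Ω × Ω → ℝ}
    (hh : IsKernelFunction h) :
    Tendsto (fun n : ℕ => expectedDensity (ULift.{u} (Fin (n + 1))) D μ h) atTop
      (𝓝 (D.configIntegral μ h)) := by
  have hratio : Tendsto (fun n : ℕ => (n.descFactorial (Fintype.card V) : ℝ) /
      (n : ℝ) ^ Fintype.card V) atTop (𝓝 1) :=
    (Asymptotics.isEquivalent_iff_tendsto_one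
      ((eventually_gt_atTop 0).mono fun n hn => by positivity)).mp
      (isEquivalent_descFactorial (Fintype.card V))
  rw [tendsto_iff_norm_sub_tendsto_zero]
  refine squeeze_zero (fun _ => abs_nonneg _)
    (fun n => abs_expectedDensity_sub_configIntegral_le μ hD hh) ?_
  -- The samples have `n + 1` vertices, hence are never empty.
  simpa using (hratio.comp (tendsto_add_atTop_nat 1)).const_sub 1

end Digraph

theorem mainTheorem7 {V W : Type*} [Fintype V] [Fintype W]
    (D : Digraph V) (F : Digraph W) (hD : D.IsLoopless) (hF : F.IsLoopless) :
    (∀ (Ω : Type*) [MeasurableSpace Ω] [StandardBorelSpace Ω]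
        (μ : Measure Ω) [IsProbabilityMeasure μ] (h : Ω × Ω → ℝ),
        IsKernelFunction h → F.configIntegral μ h ≤ D.configIntegral μ h) ↔
      (∀ (X : Type*) [Finite X] [Nonempty X] (H : Digraph X),
        H.IsLoopless → F.homDensity H ≤ D.homDensity H) := by
  classical
  constructor
  · intro hDF X _ _ H _
    -- A copy of `X` in the universe of `Ω`, with a discrete σ-algebra.
    let e : ULift (Fin (Nat.card X)) ≃ X := Equiv.ulift.trans (Finite.equivFin X).symm
    have : Nonempty (ULift (Fin (Nat.card X))) := e.nonempty
    have : DiscreteMeasurableSpace (ULift (Fin (Nat.card X))) :=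
      ⟨fun _ => MeasurableSet.of_discrete (α := Fin (Nat.card X))⟩
    have := isProbabilityMeasure_uniformOn (Ω := ULift (Fin (Nat.card X)))
      Set.finite_univ Set.univ_nonempty
    have hle := hDF (ULift (Fin (Nat.card X))) (uniformOn Set.univ)
      (fun p => if (H.pullback e).Adj p.1 p.2 then 1 else 0)
      ⟨measurable_of_finite _, fun p => by dsimp only; split_ifs <;> simp⟩
    rwa [Digraph.configIntegral_uniform, Digraph.configIntegral_uniform,
      Digraph.homDensity_pullback_equiv, Digraph.homDensity_pullback_equiv] at hle
  · intro hDF Ω _ _ μ _ h hh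
    exact le_of_tendsto_of_tendsto' (Digraph.tendsto_expectedDensity hF μ hh)
      (Digraph.tendsto_expectedDensity hD μ hh) fun n =>
        Digraph.expectedDensity_mono μ (fun H => hDF _ H) hh
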